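/- Let $n\ge 2$ and let $\mathcal L\subset\mathbb R^n$ be a full-rank integral lattice, i.e. a full-rank lattice with $\langle x,y\rangle\in\mathbb Z$ for all $x,y\in\mathcal L$. For a positive integer $k$ put $N_{=k}(\mathcal L)=|\{y\in\mathcal L:\|y\|^2=k\}|$, and say that equality holds in the shell bound at $k$ if $$N_{=k}(\mathcal L)=2\binom{n+2k-2}{2k-1}.$$ Then: 1. If equality holds in the shell bound at $k=2$, that is, $N_{=2}(\mathcal L)=2\binom{n+2}{3}$, then $n=8$. 2. Equality in the shell bound at $k=3$ never holds, that is, $N_{=3}(\mathcal L)\ne 2\binom{n+4}{5}$. -/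

import Mathlib

namespace LatticeShell

/-- A `ℤ`-submodule of `ℝⁿ` is integral if all its inner products are integers. -/
def IsIntegral {n : ℕ} (L : Submodule ℤ (EuclideanSpace ℝ (Fin n))) : Prop :=
  ∀ x ∈ L, ∀ y ∈ L, ∃ m : ℤ, inner ℝ x y = (m : ℝ)

/-- The norm-`k` shell `{y ∈ L : ‖y‖² = k}`. -/
def shell {n : ℕ} (L : Submodule ℤ (EuclideanSpace ℝ (Fin n))) (k : ℕ) :
    Set (EuclideanSpace ℝ (Fin n)) :=
  {y | y ∈ L ∧ ‖y‖ ^ 2 = (k : ℝ)}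

/-- Equality in the shell bound `|shell L k| ≤ 2 * binom (n + 2k - 2) (2k - 1)`, for `k ≥ 1`.
The right-hand side is positive for `n ≥ 1`, so the equality also says that the shell is finite
and non-empty. -/
def ShellEquality {n : ℕ} (L : Submodule ℤ (EuclideanSpace ℝ (Fin n))) (k : ℕ) : Prop :=
  (shell L k).ncard = 2 * Nat.choose (n + 2 * k - 2) (2 * k - 1)

end LatticeShell

open Finset Module

namespace LatticeShell

/-! Keep one vector of each pair `±y` in the shell. Equality makes the resulting half-shell `Y` at
least as large as the dimension of the forms of degree `2k-1`. Distinct vectors of `Y` have integer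
inner products strictly between `-k` and `k`, so the form `t ∏ (t² - j²‖z‖²/k)`, with `t = ⟨z,y⟩`
and `0 < j < k`, vanishes on `Y` except at `y`. These forms are therefore a basis, and interpolation
on `Y` is exact.

Interpolate `⟨z,a⟩‖z‖^(2k-2)` and apply the Laplacian `k-1` times: a tight frame identity remains.
Its trace, with the known value of `#Y`, is a polynomial equation in `n`. -/

/-! ### Homogeneous polynomial functions -/

/-- The homogeneous polynomial functions of degree `d` on `ℝⁿ`. -/
def homogeneousFunctions (n d : ℕ) : Submodule ℝ (EuclideanSpace ℝ (Fin n) → ℝ) :=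
  Submodule.span ℝ (Set.range fun (s : Sym (Fin n) d) (x : EuclideanSpace ℝ (Fin n)) =>
    ((s : Multiset (Fin n)).map fun i => x i).prod)

instance (n d : ℕ) : FiniteDimensional ℝ (homogeneousFunctions n d) :=
  FiniteDimensional.span_of_finite ℝ (Set.finite_range _)

lemma finrank_homogeneousFunctions_le (n d : ℕ) :
    finrank ℝ (homogeneousFunctions n d) ≤ (n + d - 1).choose d := by
  have h := finrank_range_le_card (R := ℝ)
    (fun (s : Sym (Fin n) d) (x : EuclideanSpace ℝ (Fin n)) =>
      ((s : Multiset (Fin n)).map fun i => x i).prod)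
  rwa [Sym.card_sym_eq_choose, Fintype.card_fin] at h

lemma one_mem_homogeneousFunctions (n : ℕ) :
    (fun _ => 1 : EuclideanSpace ℝ (Fin n) → ℝ) ∈ homogeneousFunctions n 0 :=
  Submodule.subset_span ⟨Sym.nil, by ext; simp⟩

lemma coord_mul_mem_homogeneousFunctions {n d : ℕ} {f : EuclideanSpace ℝ (Fin n) → ℝ}
    (hf : f ∈ homogeneousFunctions n d) (i : Fin n) :
    (fun x => x i * f x) ∈ homogeneousFunctions n (d + 1) := by
  induction hf using Submodule.span_induction with
  | mem f hf =>
    obtain ⟨s, rfl⟩ := hf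
    exact Submodule.subset_span ⟨i ::ₛ s, by ext; simp [Sym.coe_cons]⟩
  | zero =>
    convert (homogeneousFunctions n (d + 1)).zero_mem using 1
    ext; simp
  | add f g _ _ hf hg =>
    convert add_mem hf hg using 1
    ext; simp [mul_add]
  | smul r f _ hf =>
    convert Submodule.smul_mem _ r hf using 1
    ext; simp [mul_left_comm]

lemma inner_mul_mem_homogeneousFunctions {n d : ℕ} {f : EuclideanSpace ℝ (Fin n) → ℝ}
    (hf : f ∈ homogeneousFunctions n d) (y : EuclideanSpace ℝ (Fin n)) :
    (fun x => inner ℝ x y * f x) ∈ homogeneousFunctions n (d + 1) := by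
  have h : (fun x => inner ℝ x y * f x) = ∑ i, y i • fun x : EuclideanSpace ℝ (Fin n) =>
      x i * f x := by
    ext x
    simp [PiLp.inner_apply, Finset.sum_mul, mul_assoc]
  rw [h]
  exact Submodule.sum_mem _ fun i _ =>
    Submodule.smul_mem _ _ (coord_mul_mem_homogeneousFunctions hf i)

lemma normSq_mul_mem_homogeneousFunctions {n d : ℕ} {f : EuclideanSpace ℝ (Fin n) → ℝ}
    (hf : f ∈ homogeneousFunctions n d) :
    (fun x => ‖x‖ ^ 2 * f x) ∈ homogeneousFunctions n (d + 2) := by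
  have h : (fun x => ‖x‖ ^ 2 * f x) = ∑ i, fun x : EuclideanSpace ℝ (Fin n) =>
      x i * (x i * f x) := by
    ext x
    rw [EuclideanSpace.real_norm_sq_eq, Finset.sum_mul, Finset.sum_apply]
    exact Finset.sum_congr rfl fun i _ => by ring
  rw [h]
  exact Submodule.sum_mem _ fun i _ =>
    coord_mul_mem_homogeneousFunctions (coord_mul_mem_homogeneousFunctions hf i) i

/-- If `V` has dimension at most `#Y` and contains functions `F y` which separate the points
of `Y`, then Lagrange interpolation on `Y` by the `F y` is exact on `V`. -/
lemma eq_sum_of_finrank_le_card {α : Type*} {V : Submodule ℝ (α → ℝ)} [FiniteDimensional ℝ V]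
    {Y : Finset α} (hV : finrank ℝ V ≤ #Y) {F : α → α → ℝ} {c : ℝ} (hc : c ≠ 0)
    (hF : ∀ y ∈ Y, F y ∈ V) (hdiag : ∀ y ∈ Y, F y y = c)
    (hoff : ∀ x ∈ Y, ∀ y ∈ Y, x ≠ y → F y x = 0) {P : α → ℝ} (hP : P ∈ V) (x : α) :
    c * P x = ∑ y ∈ Y, P y * F y x := by
  have heval : ∀ (g : Y → ℝ) (z : Y), (∑ y, g y • F y) z = g z * c := by
    intro g z
    rw [Finset.sum_apply, Finset.sum_eq_single z]
    · simp [hdiag z z.2]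
    · intro y _ hyz
      simp [hoff z z.2 y y.2 (fun h => hyz (Subtype.ext h.symm))]
    · simp
  have hli : LinearIndependent ℝ (fun y : Y => F y) := by
    rw [Fintype.linearIndependent_iff]
    intro g hg z
    have := heval g z
    rw [hg] at this
    simpa [hc] using this.symm
  -- Independence gives `#Y` dimensions inside `V`, which has at most that many.
  have hspan : Submodule.span ℝ (Set.range fun y : Y => F y) = V := by
    refine Submodule.eq_of_le_of_finrank_le ?_ ?_
    · rw [Submodule.span_le]
      rintro _ ⟨y, rfl⟩
      exact hF y y.2
    · rw [finrank_span_eq_card hli]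
      simpa using hV
  rw [← hspan, Submodule.mem_span_range_iff_exists_fun] at hP
  obtain ⟨g, rfl⟩ := hP
  rw [← Finset.sum_coe_sort Y]
  simp_rw [heval]
  simp only [Finset.sum_apply, Pi.smul_apply, smul_eq_mul, Finset.mul_sum]
  exact Finset.sum_congr rfl fun y _ => by ring

/-! ### Half of a shell -/

/-- A finite set which is stable under negation and does not contain `0` has a half. -/
lemma exists_half {E : Type*} [AddCommGroup E] [IsAddTorsionFree E] (X : Finset E)
    (h0 : 0 ∉ X) (hneg : ∀ x ∈ X, -x ∈ X) :
    ∃ Y ⊆ X, #X = 2 * #Y ∧ ∀ x ∈ Y, ∀ y ∈ Y, x ≠ -y := by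
  classical
  let r : E → E → Prop := WellOrderingRel
  have hasymm : ∀ x y, r x y → ¬ r y x := fun x y h h' => asymm_of WellOrderingRel h h'
  have htri : ∀ x ∈ X, ¬ r x (-x) → r (-x) x := by
    intro x hx h
    rcases trichotomous_of WellOrderingRel x (-x) with h' | h' | h'
    · exact absurd h' h
    · exact absurd (self_eq_neg.mp h' ▸ hx) h0
    · exact h'
  -- Of each pair `±x`, keep the one that comes first in a well-order; negation exchanges the two
  -- halves.
  refine ⟨X.filter fun x => r x (-x), Finset.filter_subset _ _, ?_, ?_⟩
  · rw [← Finset.card_filter_add_card_filter_not (s := X) (fun x => r x (-x)), two_mul,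
      Nat.add_left_cancel_iff]
    refine Finset.card_nbij' (fun x => -x) (fun x => -x) ?_ ?_ ?_ ?_
    · intro x hx
      simp only [Finset.coe_filter, Set.mem_ofPred_eq] at hx ⊢
      exact ⟨hneg x hx.1, by simpa using htri x hx.1 hx.2⟩
    · intro x hx
      simp only [Finset.coe_filter, Set.mem_ofPred_eq] at hx ⊢
      exact ⟨hneg x hx.1, by simpa using hasymm _ _ hx.2⟩
    · simp [Set.LeftInvOn]
    · simp [Set.LeftInvOn]
  · intro x hx y hy hxy
    simp only [Finset.mem_filter] at hx hy
    subst hxy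
    exact hasymm _ _ hy.2 (by simpa using hx.2)

lemma exists_half_shell {n k : ℕ} (hn : 1 ≤ n) (hk : 1 ≤ k)
    {L : Submodule ℤ (EuclideanSpace ℝ (Fin n))} (hL : IsIntegral L) (h : ShellEquality L k) :
    ∃ Y : Finset (EuclideanSpace ℝ (Fin n)), #Y = (n + 2 * k - 2).choose (2 * k - 1) ∧
      (∀ y ∈ Y, ‖y‖ ^ 2 = (k : ℝ)) ∧
      ∀ x ∈ Y, ∀ y ∈ Y, x ≠ y → ∃ m : ℤ, inner ℝ x y = (m : ℝ) ∧ -(k : ℤ) < m ∧ m < k := by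
  classical
  have hpos : 0 < (n + 2 * k - 2).choose (2 * k - 1) := Nat.choose_pos (by omega)
  have hfin : (shell L k).Finite := Set.finite_of_ncard_ne_zero (by rw [show _ = _ from h]; omega)
  have : IsAddTorsionFree (EuclideanSpace ℝ (Fin n)) := .of_module_rat _
  obtain ⟨Y, hYX, hcard, hY⟩ := exists_half hfin.toFinset
    (by simpa [shell, eq_comm] using (by omega : k ≠ 0)) (by simp [shell])
  have hmem : ∀ y ∈ Y, y ∈ L ∧ ‖y‖ ^ 2 = (k : ℝ) := fun y hy => by
    simpa [shell] using hYX hy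
  refine ⟨Y, ?_, fun y hy => (hmem y hy).2, fun x hx y hy hxy => ?_⟩
  · rw [← Set.ncard_eq_toFinset_card _ hfin, h] at hcard
    omega
  · obtain ⟨m, hm⟩ := hL x (hmem x hx).1 y (hmem y hy).1
    have hadd := norm_add_sq_real x y
    have hsub := norm_sub_sq_real x y
    -- Strict Cauchy–Schwarz: `‖x ± y‖² = 2k ± 2m` is positive because `x ≠ ±y`.
    have hadd_pos : 0 < ‖x + y‖ ^ 2 := by
      have : x + y ≠ 0 := fun h => hY x hx y hy (eq_neg_of_add_eq_zero_left h)
      positivity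
    have hsub_pos : 0 < ‖x - y‖ ^ 2 := by
      have := sub_ne_zero.mpr hxy
      positivity
    rw [(hmem x hx).2, (hmem y hy).2, hm] at hadd hsub
    refine ⟨m, hm, ?_, ?_⟩
    · have : -(k : ℝ) < m := by linarith
      exact_mod_cast this
    · have : (m : ℝ) < k := by linarith
      exact_mod_cast this

/-! ### The Laplacian of polynomials of degree at most five -/

/-- The five-point discretisation of the Laplacian; it is exact on polynomials of degree at
most five. -/
noncomputable def discreteLaplacian {n : ℕ} (f : EuclideanSpace ℝ (Fin n) → ℝ)
    (x : EuclideanSpace ℝ (Fin n)) : ℝ :=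
  ∑ i, (16 * (f (x + (1 : ℝ) • EuclideanSpace.single i 1) +
        f (x + (-1 : ℝ) • EuclideanSpace.single i 1)) -
      (f (x + (2 : ℝ) • EuclideanSpace.single i 1) +
        f (x + (-2 : ℝ) • EuclideanSpace.single i 1)) - 30 * f x) / 12

section Laplacian

variable {n : ℕ} (x y : EuclideanSpace ℝ (Fin n))

lemma discreteLaplacian_add (f g : EuclideanSpace ℝ (Fin n) → ℝ) :
    discreteLaplacian (fun z => f z + g z) x = discreteLaplacian f x + discreteLaplacian g x := by
  simp only [discreteLaplacian, ← Finset.sum_add_distrib]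
  exact Finset.sum_congr rfl fun i _ => by ring

lemma discreteLaplacian_const_mul (r : ℝ) (f : EuclideanSpace ℝ (Fin n) → ℝ) :
    discreteLaplacian (fun z => r * f z) x = r * discreteLaplacian f x := by
  simp only [discreteLaplacian, Finset.mul_sum]
  exact Finset.sum_congr rfl fun i _ => by ring

lemma discreteLaplacian_sum {ι : Type*} (s : Finset ι) (f : ι → EuclideanSpace ℝ (Fin n) → ℝ) :
    discreteLaplacian (fun z => ∑ j ∈ s, f j z) x = ∑ j ∈ s, discreteLaplacian (f j) x := by
  simp only [discreteLaplacian]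
  rw [Finset.sum_comm]
  refine Finset.sum_congr rfl fun i _ => ?_
  rw [← Finset.sum_div]
  simp only [Finset.sum_sub_distrib, Finset.sum_add_distrib, ← Finset.mul_sum]

lemma inner_add_smul_single (r : ℝ) (i : Fin n) :
    inner ℝ (x + r • EuclideanSpace.single i 1) y = inner ℝ x y + r * y i := by
  simp [inner_add_left, inner_smul_left, EuclideanSpace.inner_single_left]

lemma normSq_add_smul_single (r : ℝ) (i : Fin n) :
    ‖x + r • EuclideanSpace.single i (1 : ℝ)‖ ^ 2 = ‖x‖ ^ 2 + 2 * r * x i + r ^ 2 := by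
  rw [norm_add_sq_real, norm_smul, inner_smul_right, EuclideanSpace.inner_single_right]
  simp
  ring

lemma sum_mul_eq_inner : ∑ i, x i * y i = inner ℝ x y := by
  simp [PiLp.inner_apply, mul_comm]

lemma sum_sq_eq_normSq : ∑ i, x i ^ 2 = ‖x‖ ^ 2 :=
  (EuclideanSpace.real_norm_sq_eq x).symm

/-- In this and the next four formulas, odd powers of the shift cancel by symmetry and fourth powers
because `16 = 2⁴`. Only the second-order term survives. -/
lemma discreteLaplacian_inner_pow_three :
    discreteLaplacian (fun z => inner ℝ z y ^ 3) x = 6 * ‖y‖ ^ 2 * inner ℝ x y := by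
  simp only [discreteLaplacian, inner_add_smul_single]
  rw [← sum_sq_eq_normSq, Finset.mul_sum, Finset.sum_mul]
  exact Finset.sum_congr rfl fun i _ => by ring

lemma discreteLaplacian_inner_mul_normSq :
    discreteLaplacian (fun z => inner ℝ z y * ‖z‖ ^ 2) x = (2 * n + 4) * inner ℝ x y := by
  simp only [discreteLaplacian, inner_add_smul_single, normSq_add_smul_single]
  have h : ((2 : ℝ) * n + 4) * inner ℝ x y =
      ∑ i : Fin n, (2 * inner ℝ x y + 4 * (x i * y i)) := by
    rw [Finset.sum_add_distrib, ← Finset.mul_sum, ← Finset.mul_sum, sum_mul_eq_inner]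
    simp
    ring
  rw [h]
  exact Finset.sum_congr rfl fun i _ => by ring

lemma discreteLaplacian_inner_pow_five :
    discreteLaplacian (fun z => inner ℝ z y ^ 5) x = 20 * ‖y‖ ^ 2 * inner ℝ x y ^ 3 := by
  simp only [discreteLaplacian, inner_add_smul_single]
  rw [← sum_sq_eq_normSq, Finset.mul_sum, Finset.sum_mul]
  exact Finset.sum_congr rfl fun i _ => by ring

lemma discreteLaplacian_inner_pow_three_mul_normSq :
    discreteLaplacian (fun z => inner ℝ z y ^ 3 * ‖z‖ ^ 2) x =
      6 * ‖y‖ ^ 2 * (inner ℝ x y * ‖x‖ ^ 2) + (2 * n + 12) * inner ℝ x y ^ 3 := by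
  simp only [discreteLaplacian, inner_add_smul_single, normSq_add_smul_single]
  have h : 6 * ‖y‖ ^ 2 * (inner ℝ x y * ‖x‖ ^ 2) + ((2 : ℝ) * n + 12) * inner ℝ x y ^ 3 =
      ∑ i : Fin n, (6 * inner ℝ x y * ‖x‖ ^ 2 * y i ^ 2 + 2 * inner ℝ x y ^ 3 +
        12 * inner ℝ x y ^ 2 * (x i * y i)) := by
    rw [Finset.sum_add_distrib, Finset.sum_add_distrib, ← Finset.mul_sum, ← Finset.mul_sum,
      ← Finset.mul_sum, sum_mul_eq_inner, sum_sq_eq_normSq]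
    simp
    ring
  rw [h]
  exact Finset.sum_congr rfl fun i _ => by ring

lemma discreteLaplacian_inner_mul_norm_pow_four :
    discreteLaplacian (fun z => inner ℝ z y * (‖z‖ ^ 2) ^ 2) x =
      (4 * n + 16) * (inner ℝ x y * ‖x‖ ^ 2) := by
  simp only [discreteLaplacian, inner_add_smul_single, normSq_add_smul_single]
  have h : ((4 : ℝ) * n + 16) * (inner ℝ x y * ‖x‖ ^ 2) =
      ∑ i : Fin n, (4 * inner ℝ x y * ‖x‖ ^ 2 + 8 * inner ℝ x y * x i ^ 2 +
        8 * ‖x‖ ^ 2 * (x i * y i)) := by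
    rw [Finset.sum_add_distrib, Finset.sum_add_distrib, ← Finset.mul_sum, ← Finset.mul_sum,
      ← Finset.mul_sum, sum_mul_eq_inner, sum_sq_eq_normSq]
    simp
    ring
  rw [h]
  exact Finset.sum_congr rfl fun i _ => by ring

end Laplacian

/-- Comparison of traces in a multiple of the tight frame identity. -/
lemma mul_card_eq_of_frame {n : ℕ} {Y : Finset (EuclideanSpace ℝ (Fin n))} {k A B : ℝ}
    (hk : ∀ y ∈ Y, ‖y‖ ^ 2 = k)
    (h : ∀ a x : EuclideanSpace ℝ (Fin n),
      A * inner ℝ x a = B * ∑ y ∈ Y, inner ℝ y a * inner ℝ x y) :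
    A * n = B * (k * #Y) := by
  have hsum : ∑ i : Fin n, ∑ y ∈ Y, y i * y i = k * #Y := by
    rw [Finset.sum_comm, Finset.sum_congr rfl fun y hy => by
      rw [sum_mul_eq_inner, real_inner_self_eq_norm_sq, hk y hy]]
    simp [mul_comm]
  have htrace := Finset.sum_congr rfl fun (i : Fin n) (_ : i ∈ Finset.univ) =>
    h (EuclideanSpace.single i 1) (EuclideanSpace.single i 1)
  rw [← Finset.mul_sum, ← Finset.mul_sum] at htrace
  simpa [EuclideanSpace.inner_single_left, EuclideanSpace.inner_single_right, hsum] using htrace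

/-! ### Equality at `k = 2` and `k = 3` -/

/-- The interpolating form restricts to `t(t² - 1)` on the shell, with value `6` at `t = 2`. One
Laplacian makes both sides linear. -/
theorem frame_of_shellEquality_two {n : ℕ} {Y : Finset (EuclideanSpace ℝ (Fin n))}
    (hcard : #Y = (n + 2).choose 3) (hnorm : ∀ y ∈ Y, ‖y‖ ^ 2 = (2 : ℝ))
    (hinner : ∀ x ∈ Y, ∀ y ∈ Y, x ≠ y → ∃ m : ℤ, inner ℝ x y = (m : ℝ) ∧ -2 < m ∧ m < 2)
    (a x : EuclideanSpace ℝ (Fin n)) :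
    6 * (2 * n + 4) * inner ℝ x a =
      (20 - 2 * n) * ∑ y ∈ Y, inner ℝ y a * inner ℝ x y := by
  have hlin : ∀ y : EuclideanSpace ℝ (Fin n),
      (fun x => inner ℝ x y) ∈ homogeneousFunctions n 1 := fun y => by
    simpa using inner_mul_mem_homogeneousFunctions (one_mem_homogeneousFunctions n) y
  have hrep : ∀ z, 6 * (inner ℝ z a * ‖z‖ ^ 2) =
      ∑ y ∈ Y, inner ℝ y a * ‖y‖ ^ 2 *
        (inner ℝ z y ^ 3 + -(1 / 2) * (inner ℝ z y * ‖z‖ ^ 2)) := by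
    refine eq_sum_of_finrank_le_card (V := homogeneousFunctions n 3)
      (F := fun y z => inner ℝ z y ^ 3 + -(1 / 2) * (inner ℝ z y * ‖z‖ ^ 2))
      (P := fun z => inner ℝ z a * ‖z‖ ^ 2)
      (by rw [hcard]; exact finrank_homogeneousFunctions_le n 3) (by norm_num) ?_ ?_ ?_ ?_
    · intro y _
      have h₁ := inner_mul_mem_homogeneousFunctions
        (inner_mul_mem_homogeneousFunctions (hlin y) y) y
      have h₂ := normSq_mul_mem_homogeneousFunctions (hlin y)
      convert add_mem h₁ (Submodule.smul_mem _ (-(1 / 2) : ℝ) h₂) using 1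
      ext z
      simp only [Pi.add_apply, Pi.smul_apply, smul_eq_mul]
      ring
    · intro y hy
      simp only [real_inner_self_eq_norm_sq, hnorm y hy]
      norm_num
    · intro x hx y hy hxy
      obtain ⟨m, hm, h₁, h₂⟩ := hinner x hx y hy hxy
      simp only [hm, hnorm x hx]
      interval_cases m <;> norm_num
    · convert normSq_mul_mem_homogeneousFunctions (hlin a) using 1
      ext z
      ring
  have hlap := congrArg (fun f => discreteLaplacian f x) (funext hrep)
  simp only [discreteLaplacian_sum, discreteLaplacian_const_mul, discreteLaplacian_add,
    discreteLaplacian_inner_pow_three, discreteLaplacian_inner_mul_normSq] at hlap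
  rw [mul_assoc, hlap, Finset.mul_sum]
  refine Finset.sum_congr rfl fun y hy => ?_
  rw [hnorm y hy]
  ring

/-- Here the form restricts to `t(t² - 1)(t² - 4)`, with value `120` at `t = 3`; the coefficients
`5/3` and `4/9` come from homogenising with `‖z‖² = 3`. Two Laplacians are needed. -/
theorem frame_of_shellEquality_three {n : ℕ} {Y : Finset (EuclideanSpace ℝ (Fin n))}
    (hcard : #Y = (n + 4).choose 5) (hnorm : ∀ y ∈ Y, ‖y‖ ^ 2 = (3 : ℝ))
    (hinner : ∀ x ∈ Y, ∀ y ∈ Y, x ≠ y → ∃ m : ℤ, inner ℝ x y = (m : ℝ) ∧ -3 < m ∧ m < 3)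
    (a x : EuclideanSpace ℝ (Fin n)) :
    120 * (4 * n + 16) * (2 * n + 4) * inner ℝ x a =
      8 * (4 * n ^ 2 - 111 * n + 707) * ∑ y ∈ Y, inner ℝ y a * inner ℝ x y := by
  have hlin : ∀ y : EuclideanSpace ℝ (Fin n),
      (fun x => inner ℝ x y) ∈ homogeneousFunctions n 1 := fun y => by
    simpa using inner_mul_mem_homogeneousFunctions (one_mem_homogeneousFunctions n) y
  have hrep : ∀ z, 120 * (inner ℝ z a * (‖z‖ ^ 2) ^ 2) =
      ∑ y ∈ Y, inner ℝ y a * (‖y‖ ^ 2) ^ 2 *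
        (inner ℝ z y ^ 5 + (-(5 / 3) * (inner ℝ z y ^ 3 * ‖z‖ ^ 2) +
          4 / 9 * (inner ℝ z y * (‖z‖ ^ 2) ^ 2))) := by
    refine eq_sum_of_finrank_le_card (V := homogeneousFunctions n 5)
      (F := fun y z => inner ℝ z y ^ 5 + (-(5 / 3) * (inner ℝ z y ^ 3 * ‖z‖ ^ 2) +
          4 / 9 * (inner ℝ z y * (‖z‖ ^ 2) ^ 2)))
      (P := fun z => inner ℝ z a * (‖z‖ ^ 2) ^ 2)
      (by rw [hcard]; exact finrank_homogeneousFunctions_le n 5) (by norm_num) ?_ ?_ ?_ ?_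
    · intro y _
      have h₁ := inner_mul_mem_homogeneousFunctions
        (inner_mul_mem_homogeneousFunctions (hlin y) y) y
      have h₂ := inner_mul_mem_homogeneousFunctions
        (inner_mul_mem_homogeneousFunctions h₁ y) y
      have h₃ := normSq_mul_mem_homogeneousFunctions h₁
      have h₄ := normSq_mul_mem_homogeneousFunctions
        (normSq_mul_mem_homogeneousFunctions (hlin y))
      convert add_mem h₂ (add_mem (Submodule.smul_mem _ (-(5 / 3) : ℝ) h₃)
        (Submodule.smul_mem _ (4 / 9 : ℝ) h₄)) using 1
      ext z
      simp only [Pi.add_apply, Pi.smul_apply, smul_eq_mul]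
      ring
    · intro y hy
      simp only [real_inner_self_eq_norm_sq, hnorm y hy]
      norm_num
    · intro x hx y hy hxy
      obtain ⟨m, hm, h₁, h₂⟩ := hinner x hx y hy hxy
      simp only [hm, hnorm x hx]
      interval_cases m <;> norm_num
    · convert normSq_mul_mem_homogeneousFunctions
        (normSq_mul_mem_homogeneousFunctions (hlin a)) using 1
      ext z
      ring
  have hlap : ∀ z, 120 * (4 * n + 16) * (inner ℝ z a * ‖z‖ ^ 2) =
      ∑ y ∈ Y, inner ℝ y a * ((360 - 30 * n) * inner ℝ z y ^ 3 +
        (16 * n - 206) * (inner ℝ z y * ‖z‖ ^ 2)) := by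
    intro z
    have h := congrArg (fun f => discreteLaplacian f z) (funext hrep)
    simp only [discreteLaplacian_sum, discreteLaplacian_const_mul, discreteLaplacian_add,
      discreteLaplacian_inner_pow_five, discreteLaplacian_inner_pow_three_mul_normSq,
      discreteLaplacian_inner_mul_norm_pow_four] at h
    rw [mul_assoc, h]
    refine Finset.sum_congr rfl fun y hy => ?_
    rw [hnorm y hy]
    ring
  have hlap₂ := congrArg (fun f => discreteLaplacian f x) (funext hlap)
  simp only [discreteLaplacian_sum, discreteLaplacian_const_mul, discreteLaplacian_add,
    discreteLaplacian_inner_pow_three, discreteLaplacian_inner_mul_normSq] at hlap₂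
  rw [mul_assoc, hlap₂, Finset.mul_sum]
  refine Finset.sum_congr rfl fun y hy => ?_
  rw [hnorm y hy]
  ring

theorem eq_eight_of_shellEquality_two {n : ℕ} (hn : 2 ≤ n)
    {L : Submodule ℤ (EuclideanSpace ℝ (Fin n))} (hL : IsIntegral L) (h : ShellEquality L 2) :
    n = 8 := by
  obtain ⟨Y, hcard, hnorm, hinner⟩ := exists_half_shell (by omega) (by omega) hL h
  have hcard' : #Y = (n + 2).choose 3 := hcard
  have htrace := mul_card_eq_of_frame (k := 2) (by exact_mod_cast hnorm)
    (frame_of_shellEquality_two hcard' (by exact_mod_cast hnorm) (by exact_mod_cast hinner))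
  have hN : (#Y : ℝ) * 6 = (n + 2) * (n + 1) * n := by
    have := Nat.descFactorial_eq_factorial_mul_choose (n + 2) 3
    rw [← hcard'] at this
    simp [Nat.descFactorial_succ, Nat.factorial] at this
    have := congrArg (Nat.cast : ℕ → ℝ) this
    push_cast at this
    linarith
  have hn' : (2 : ℝ) ≤ n := by exact_mod_cast hn
  -- Eliminating `#Y` leaves `(10 - n)(n + 1) = 18`, up to the factor `n(n + 2)`; the other root `n
  -- = 1` is excluded by `2 ≤ n`.
  have hprod : (n * (n + 2) * (n - 1) : ℝ) * (n - 8) = 0 := by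
    linear_combination (3 / 2 : ℝ) * htrace + (10 - n) * hN
  have hpos : (0 : ℝ) < n * (n + 2) * (n - 1) :=
    mul_pos (by positivity) (by linarith)
  have := (mul_eq_zero.mp hprod).resolve_left hpos.ne'
  exact_mod_cast sub_eq_zero.mp this

theorem not_shellEquality_three {n : ℕ} (hn : 2 ≤ n)
    {L : Submodule ℤ (EuclideanSpace ℝ (Fin n))} (hL : IsIntegral L) : ¬ ShellEquality L 3 := by
  intro h
  obtain ⟨Y, hcard, hnorm, hinner⟩ := exists_half_shell (by omega) (by omega) hL h
  have hcard' : #Y = (n + 4).choose 5 := hcard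
  have htrace := mul_card_eq_of_frame (k := 3) (by exact_mod_cast hnorm)
    (frame_of_shellEquality_three hcard' (by exact_mod_cast hnorm) (by exact_mod_cast hinner))
  have hN : (#Y : ℝ) * 120 = (n + 4) * (n + 3) * (n + 2) * (n + 1) * n := by
    have := Nat.descFactorial_eq_factorial_mul_choose (n + 4) 5
    rw [← hcard'] at this
    simp [Nat.descFactorial_succ, Nat.factorial] at this
    have := congrArg (Nat.cast : ℕ → ℝ) this
    push_cast at this
    linarith
  have hn' : (2 : ℝ) ≤ n := by exact_mod_cast hn
  have hprod : (n * (n + 2) * (n + 4) * (n - 1) : ℝ) *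
      (4 * n ^ 3 - 91 * n ^ 2 + 184 * n + 2679) = 0 := by
    linear_combination (-5 : ℝ) * htrace - (4 * n ^ 2 - 111 * n + 707) * hN
  have hpos : (0 : ℝ) < n * (n + 2) * (n + 4) * (n - 1) :=
    mul_pos (by positivity) (by linarith)
  have hroot := (mul_eq_zero.mp hprod).resolve_left hpos.ne'
  have hroot' : 4 * n ^ 3 + 184 * n + 2679 = 91 * n ^ 2 := by
    have : (4 * n ^ 3 + 184 * n + 2679 : ℝ) = 91 * n ^ 2 := by linarith
    exact_mod_cast this
  -- From `n = 23` on, `4n ≥ 92 > 91`, so the cubic term alone exceeds `91n²`.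
  have hlt : n < 23 := by
    by_contra! hge
    nlinarith [Nat.mul_le_mul_right (n ^ 2) hge]
  interval_cases n <;> omega

end LatticeShell

theorem proposition4p2 (n : ℕ) (hn : 2 ≤ n)
    (L : Submodule ℤ (EuclideanSpace ℝ (Fin n))) [DiscreteTopology L] [IsZLattice ℝ L]
    (hL : LatticeShell.IsIntegral L) :
    (LatticeShell.ShellEquality L 2 → n = 8) ∧ ¬ LatticeShell.ShellEquality L 3 :=
  ⟨LatticeShell.eq_eight_of_shellEquality_two hn hL, LatticeShell.not_shellEquality_three hn hL⟩
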